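/- Let $n,k,s\ge 0$ be integers, and let $\mathbf{a}^{1},\dots,\mathbf{a}^{k}\in\mathbb{R}^{n}$ be pairwise linearly independent vectors. Suppose that there is a nonsingular linear transformation $T:\mathbb{R}^{n}\to\mathbb{R}^{n}$ such that $T\mathbf{a}^{i}\in\mathbb{Q}^{n}$ for $i=1,\dots,k$. Let $f\in C^{s}(\mathbb{R}^{n})$ (that is, $f:\mathbb{R}^n\to\mathbb{R}$ is $s$ times continuously differentiable, with $C^{0}=C$), and suppose that there are arbitrary functions $f_{1},\dots,f_{k}:\mathbb{R}\to\mathbb{R}$ (no regularity is assumed) such that $$f(\mathbf{x})=\sum_{i=1}^{k}f_{i}(\mathbf{a}^{i}\cdot\mathbf{x})\qquad\text{for all }\mathbf{x}\in\mathbb{R}^{n},$$ where $\cdot$ is the standard inner product. Then there exist functions $g_{1},\dots,g_{k}\in C^{s}(\mathbb{R})$ such that $$f(\mathbf{x})=\sum_{i=1}^{k}g_{i}(\mathbf{a}^{i}\cdot\mathbf{x})\qquad\text{for all }\mathbf{x}\in\mathbb{R}^{n}.$$ -/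

import Mathlib

universe u

/-! Fix `i` with `a i ≠ 0`. Pairwise independence gives vectors `b j` with `⟪a i, b j⟫ = 1` and `⟪a
j, b j⟫ = 0` for `j ≠ i`. Differencing `f` along all `p j • b j` kills every summand but the `i`-th,
so the `k`-th iterated difference of `φ i` is `C^s` in `p`. The order of the difference is then
lowered one at a time, over `ℚ` only: a `C^s` cocycle is the Cauchy difference of an explicit `C^s`
function, and what remains is additive, hence linear on `ℚ`, whereas on `ℝ` it could be wild. So `φ
i` agrees on `ℚ` with some `C^s` function `g i`. Rationality of `T (a i)` makes every `⟪a i, x⟫`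
rational for `x` in a dense set, and continuity extends the identity. -/

open scoped Topology in
/-- The integral over `[0, 1]` of a `C^s` function is a `C^s` function of its parameter. -/
theorem contDiff_intervalIntegral_unit {E : Type u} [NormedAddCommGroup E] [NormedSpace ℝ E]
    [FiniteDimensional ℝ E] (s : ℕ) :
    ∀ {V : Type u} [NormedAddCommGroup V] [NormedSpace ℝ V] {F : E × ℝ → V},
      ContDiff ℝ s F → ContDiff ℝ s fun x => ∫ u in (0 : ℝ)..1, F (x, u) := by
  -- `V` varies in the induction because the derivative takes values in `E →L[ℝ] V`.
  induction s with
  | zero =>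
    intro V _ _ F hF
    have hc : Continuous F := hF.continuous
    refine contDiff_zero.2 ?_
    exact intervalIntegral.continuous_parametric_intervalIntegral_of_continuous'
      (f := fun x u => F (x, u)) (by simpa [Function.uncurry_def] using hc) 0 1
  | succ s ih =>
    intro V _ _ F hF
    have : ProperSpace E := FiniteDimensional.proper ℝ E
    obtain ⟨F', hF', hd⟩ := contDiff_succ_iff_hasFDerivAt.1 hF
    let G : E × ℝ → (E →L[ℝ] V) := fun p => (F' p).comp (ContinuousLinearMap.inl ℝ E ℝ)
    have hG : ContDiff ℝ s G := hF'.clm_comp contDiff_const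
    have hGc : Continuous G := hG.continuous
    have hFc : Continuous F := hF.continuous
    refine contDiff_succ_iff_hasFDerivAt.2
      ⟨fun x => ∫ u in (0 : ℝ)..1, G (x, u), ih hG, fun x => ?_⟩
    obtain ⟨M, hM⟩ := ((isCompact_closedBall x 1).prod
      (isCompact_Icc (a := (0 : ℝ)) (b := 1))).exists_bound_of_continuousOn hGc.continuousOn
    refine (intervalIntegral.hasFDerivAt_integral_of_dominated_of_fderiv_le
      (F := fun x u => F (x, u)) (F' := fun x u => G (x, u)) (bound := fun _ => M)
      (Metric.ball_mem_nhds x one_pos) ?_ ?_ ?_ ?_ ?_ ?_)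
    · exact Filter.Eventually.of_forall fun y =>
        (hFc.comp (by fun_prop : Continuous fun u : ℝ => (y, u))).aestronglyMeasurable
    · exact (hFc.comp (by fun_prop : Continuous fun u : ℝ => (x, u))).intervalIntegrable _ _
    · exact (hGc.comp (by fun_prop : Continuous fun u : ℝ => (x, u))).aestronglyMeasurable
    · refine Filter.Eventually.of_forall fun u hu y hy => hM (y, u) ⟨Metric.ball_subset_closedBall hy, ?_⟩
      rw [Set.uIoc_of_le zero_le_one] at hu
      exact Set.Ioc_subset_Icc_self hu
    · exact intervalIntegrable_const
    · refine Filter.Eventually.of_forall fun u _ y _ => ?_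
      exact (hd (y, u)).comp y (hasFDerivAt_prodMk_left y u)

/-- An explicit solution of the cocycle equation: a continuous cocycle on `ℝ` is the
Cauchy difference of `x ↦ x ∫₀¹ c (x u) 1 du - ∫₀¹ c x u du`. -/
theorem cocycle_eq_cauchy_difference {c : ℝ → ℝ → ℝ} (hc : Continuous fun p : ℝ × ℝ => c p.1 p.2)
    (h : ∀ x y z, c x y + c (x + y) z = c y z + c x (y + z)) {g : ℝ → ℝ}
    (hg : ∀ x, g x = x * (∫ u in (0 : ℝ)..1, c (x * u) 1) - ∫ u in (0 : ℝ)..1, c x u) (x y : ℝ) :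
    c x y = g (x + y) - g x - g y := by
  have hx : ∀ x, Continuous fun u => c x u := fun x => hc.comp (by fun_prop : Continuous fun u : ℝ => (x, u))
  have h1 : Continuous fun u => c u 1 := hc.comp (by fun_prop : Continuous fun u : ℝ => (u, (1 : ℝ)))
  have h1x : Continuous fun u => c (x + u) 1 := h1.comp (continuous_const.add continuous_id)
  have hxy : Continuous fun u => c x (y + u) := (hx x).comp (continuous_const.add continuous_id)
  have hx1 : Continuous fun u => c x (u + 1) := (hx x).comp (continuous_id.add continuous_const)
  have hη : ∀ x : ℝ, x * (∫ u in (0 : ℝ)..1, c (x * u) 1) = ∫ u in (0 : ℝ)..x, c u 1 := by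
    intro x
    have := intervalIntegral.mul_integral_comp_mul_left (f := fun u => c u 1) (a := 0) (b := 1) x
    simpa using this
  simp only [hg, hη]
  have hint : ∀ (f : ℝ → ℝ), Continuous f → ∀ a b, IntervalIntegrable f MeasureTheory.volume a b :=
    fun f hf a b => hf.intervalIntegrable a b
  -- integrate the cocycle equation in its third variable
  have e1 : (∫ u in (0 : ℝ)..1, (c x y + c (x + y) u)) = ∫ u in (0 : ℝ)..1, (c y u + c x (y + u)) :=
    intervalIntegral.integral_congr fun u _ => h x y u
  rw [intervalIntegral.integral_add (hint _ continuous_const _ _) (hint _ (hx _) _ _),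
    intervalIntegral.integral_add (hint _ (hx _) _ _)
      (hint _ hxy _ _),
    intervalIntegral.integral_comp_add_left (fun u => c x u) y] at e1
  -- shift the window of integration back to the unit interval
  have e2 : (∫ u in (0 : ℝ)..y, (c x u + c (x + u) 1)) = ∫ u in (0 : ℝ)..y, (c u 1 + c x (u + 1)) :=
    intervalIntegral.integral_congr fun u _ => h x u 1
  rw [intervalIntegral.integral_add (hint _ (hx _) _ _)
      (hint _ h1x _ _),
    intervalIntegral.integral_add (hint _ h1 _ _)
      (hint _ hx1 _ _),
    intervalIntegral.integral_comp_add_left (fun u => c u 1) x,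
    intervalIntegral.integral_comp_add_right (fun u => c x u) 1] at e2
  have e3 := intervalIntegral.integral_add_adjacent_intervals (hint _ h1 0 x) (hint _ h1 x (x + y))
  have e4 := intervalIntegral.integral_add_adjacent_intervals (hint _ (hx x) 0 y) (hint _ (hx x) y (y + 1))
  have e5 := intervalIntegral.integral_add_adjacent_intervals (hint _ (hx x) 0 1) (hint _ (hx x) 1 (y + 1))
  simp at e1 e2
  linarith

/-- If the Cauchy difference in `x ∈ ℚ` of a family `Φ x p` is the restriction of a `C^s` function of
all the variables, then so is `Φ x p - x * Φ 1 p`. -/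
theorem contDiff_extension_of_cauchy_difference {E : Type} [NormedAddCommGroup E] [NormedSpace ℝ E]
    [FiniteDimensional ℝ E] {P : Type*} {e : P → E} (he : DenseRange e) {s : ℕ} {Φ : ℚ → P → ℝ}
    {C : ℝ × ℝ × E → ℝ} (hC : ContDiff ℝ s C)
    (hΦ : ∀ (x y : ℚ) (p : P), C (x, y, e p) = Φ (x + y) p - Φ x p - Φ y p) :
    ∃ G : ℝ × E → ℝ, ContDiff ℝ s G ∧ ∀ (x : ℚ) (p : P), G (x, e p) = Φ x p - x * Φ 1 p := by
  have hCc : Continuous C := hC.continuous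
  have hcoc : ∀ (x y z : ℝ) (p : E),
      C (x, y, p) + C (x + y, z, p) = C (y, z, p) + C (x, y + z, p) := by
    -- The identity is formal at rational points, where `C` is a Cauchy difference, and extends by
    -- density.
    have hd : DenseRange (Prod.map ((↑) : ℚ → ℝ) (Prod.map ((↑) : ℚ → ℝ)
        (Prod.map ((↑) : ℚ → ℝ) e))) :=
      Rat.denseRange_cast.prodMap (Rat.denseRange_cast.prodMap (Rat.denseRange_cast.prodMap he))
    have := hd.equalizer
      (g := fun q => C (q.1, q.2.1, q.2.2.2) + C (q.1 + q.2.1, q.2.2.1, q.2.2.2))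
      (h := fun q => C (q.2.1, q.2.2.1, q.2.2.2) + C (q.1, q.2.1 + q.2.2.1, q.2.2.2))
      (by fun_prop) (by fun_prop) (by
        funext ⟨x, y, z, p⟩
        simp only [Function.comp_apply, Prod.map_apply]
        rw [← Rat.cast_add, ← Rat.cast_add, hΦ, hΦ, hΦ, hΦ, add_assoc]
        ring)
    intro x y z p
    exact congrFun this (x, y, z, p)
  let G₀ : ℝ × E → ℝ := fun q =>
    q.1 * (∫ u in (0 : ℝ)..1, C (q.1 * u, 1, q.2)) - ∫ u in (0 : ℝ)..1, C (q.1, u, q.2)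
  have hG₀ : ContDiff ℝ s G₀ := by
    refine (contDiff_fst.mul ?_).sub ?_
    · exact contDiff_intervalIntegral_unit s
        (F := fun q : (ℝ × E) × ℝ => C (q.1.1 * q.2, 1, q.1.2)) (hC.comp (by fun_prop))
    · exact contDiff_intervalIntegral_unit s
        (F := fun q : (ℝ × E) × ℝ => C (q.1.1, q.2, q.1.2)) (hC.comp (by fun_prop))
  have hdiff : ∀ (x y : ℝ) (p : E), C (x, y, p) = G₀ (x + y, p) - G₀ (x, p) - G₀ (y, p) :=
    fun x y p => cocycle_eq_cauchy_difference (c := fun x y => C (x, y, p))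
      (hCc.comp (by fun_prop)) (fun x y z => hcoc x y z p) (g := fun x => G₀ (x, p))
      (fun _ => rfl) x y
  refine ⟨fun q => G₀ q - q.1 * G₀ (1, q.2), ?_, fun x p => ?_⟩
  · exact hG₀.sub (contDiff_fst.mul (hG₀.comp (by fun_prop)))
  -- The discrepancy is additive on `ℚ`, so `A x = x * A 1`.
  · let A : ℚ →+ ℝ := AddMonoidHom.mk' (fun x => Φ x p - G₀ (x, e p)) fun x y => by
      have h1 := hΦ x y p
      rw [hdiff] at h1
      push_cast
      linarith
    have h1 := map_rat_smul A x 1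
    have hA : ∀ y : ℚ, A y = Φ y p - G₀ (y, e p) := fun _ => rfl
    rw [smul_eq_mul, mul_one, hA, hA, Rat.smul_def, Rat.cast_one] at h1
    simp only
    linarith

theorem denseRange_ratCast_pi (ι : Type*) :
    DenseRange fun (p : ι → ℚ) (i : ι) => (p i : ℝ) :=
  DenseRange.piMap (f := fun _ : ι => ((↑) : ℚ → ℝ)) fun _ => Rat.denseRange_cast

/-- A function on `ℚ^m` whose Cauchy differences in each variable are restrictions of `C^s`
functions is itself the restriction of a `C^s` function. -/
theorem contDiff_extension_of_separate_cauchy_differences {m s : ℕ} {B : (Fin m → ℚ) → ℝ}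
    (h : ∀ i, ∃ C : ℝ × ℝ × (Fin m → ℝ) → ℝ, ContDiff ℝ s C ∧ ∀ (x y : ℚ) (p : Fin m → ℚ),
      C (x, y, fun j => (p j : ℝ)) = B (Function.update p i (x + y)) - B (Function.update p i x)
        - B (Function.update p i y)) :
    ∃ G : (Fin m → ℝ) → ℝ, ContDiff ℝ s G ∧ ∀ p : Fin m → ℚ, G (fun j => (p j : ℝ)) = B p := by
  have step : ∀ i, ∃ G : (Fin m → ℝ) → ℝ, ContDiff ℝ s G ∧ ∀ p : Fin m → ℚ,
      G (fun j => (p j : ℝ)) = B p - p i * B (Function.update p i 1) := by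
    intro i
    obtain ⟨C, hC, hCB⟩ := h i
    obtain ⟨G, hG, hGB⟩ := contDiff_extension_of_cauchy_difference
      (denseRange_ratCast_pi (Fin m)) (Φ := fun x p => B (Function.update p i x)) hC hCB
    refine ⟨fun p => G (p i, p), hG.comp (by fun_prop), fun p => ?_⟩
    simpa using hGB (p i) p
  -- The variables are frozen at `1` one by one; once all are, the remainder is a constant times `∏
  -- p j`.
  have key : ∀ S : Finset (Fin m), ∃ G : (Fin m → ℝ) → ℝ, ContDiff ℝ s G ∧ ∀ p : Fin m → ℚ,
      G (fun j => (p j : ℝ)) = B p - (∏ j ∈ S, (p j : ℝ)) * B (fun j => if j ∈ S then 1 else p j) := by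
    intro S
    induction S using Finset.induction_on with
    | empty => exact ⟨0, contDiff_const, fun p => by simp⟩
    | insert i S hi ih =>
      obtain ⟨G, hG, hGB⟩ := ih
      obtain ⟨G', hG', hGB'⟩ := step i
      refine ⟨fun p => G p + (∏ j ∈ S, p j) * G' (fun j => if j ∈ S then 1 else p j),
        hG.add ((contDiff_prod fun j _ => contDiff_apply ℝ ℝ j).mul (hG'.comp ?_)), fun p => ?_⟩
      · refine contDiff_pi.2 fun j => ?_
        split_ifs
        · exact contDiff_const
        · exact contDiff_apply ℝ ℝ j
      · have h1 := hGB' fun j => if j ∈ S then 1 else p j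
        have e1 : (fun j => (((if j ∈ S then 1 else p j : ℚ)) : ℝ))
            = fun j => if j ∈ S then (1 : ℝ) else (p j : ℝ) := by
          funext j; split_ifs <;> simp
        have e2 : Function.update (fun j => if j ∈ S then (1 : ℚ) else p j) i 1
            = fun j => if j ∈ insert i S then 1 else p j := by
          funext j
          by_cases hj : j = i
          · subst hj; simp
          · simp [hj]
        rw [e1, e2, if_neg hi] at h1
        beta_reduce
        rw [hGB, h1, Finset.prod_insert hi]
        ring
  obtain ⟨G, hG, hGB⟩ := key Finset.univ
  refine ⟨fun p => G p + (∏ j, p j) * B fun _ => 1,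
    hG.add ((contDiff_prod fun j _ => contDiff_apply ℝ ℝ j).mul contDiff_const), fun p => ?_⟩
  simp [hGB]

/-! ### Iterated differences -/

/-- The iterated difference of `φ` at `0` with increments `p 0, …, p (m - 1)`, up to the sign
`(-1) ^ m`. -/
noncomputable def iteratedDiff {A : Type*} [AddCommMonoid A] {m : ℕ} (φ : A → ℝ)
    (p : Fin m → A) : ℝ :=
  ∑ ε : Fin m → Bool, (∏ j, if ε j then (-1 : ℝ) else 1) * φ (∑ j, if ε j then p j else 0)

theorem iteratedDiff_insertNth {A : Type*} [AddCommMonoid A] {m : ℕ} (φ : A → ℝ) (i : Fin (m + 1))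
    (x : A) (q : Fin m → A) :
    iteratedDiff φ (i.insertNth x q : Fin (m + 1) → A) =
      iteratedDiff φ q - iteratedDiff (fun t => φ (t + x)) q := by
  unfold iteratedDiff
  rw [← (Fin.insertNthEquiv (fun _ => Bool) i).sum_comp, Fintype.sum_prod_type]
  simp [Fin.sum_univ_succAbove _ i, Fin.prod_univ_succAbove _ i, add_comm, sub_eq_add_neg]

/-- With `τ` for translation, each increment `x` contributes a factor `1 - τ_x`, and `(1 - τ_x τ_y)
- (1 - τ_x) - (1 - τ_y) = -(1 - τ_x)(1 - τ_y)`. -/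
theorem iteratedDiff_add_sub {A : Type*} [AddCommMonoid A] {m : ℕ} (φ : A → ℝ) (i : Fin (m + 1))
    (x y : A) (q : Fin m → A) :
    iteratedDiff φ (i.insertNth (x + y) q : Fin (m + 1) → A)
        - iteratedDiff φ (i.insertNth x q : Fin (m + 1) → A)
        - iteratedDiff φ (i.insertNth y q : Fin (m + 1) → A)
      = - iteratedDiff φ (Fin.cons x (Fin.cons y q : Fin (m + 1) → A) : Fin (m + 2) → A) := by
  rw [← Fin.insertNth_zero', ← Fin.insertNth_zero']
  simp only [iteratedDiff_insertNth, add_assoc]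
  simp only [add_comm y x]
  ring

theorem iteratedDiff_eq_zero {A : Type*} [AddCommMonoid A] {m : ℕ} (φ : A → ℝ) {p : Fin m → A}
    (i : Fin m) (hp : p i = 0) : iteratedDiff φ p = 0 := by
  obtain ⟨m, rfl⟩ : ∃ m', m = m' + 1 := ⟨m - 1, by have := i.isLt; omega⟩
  rw [← Fin.insertNth_self_removeNth i p, hp, iteratedDiff_insertNth]
  simp

theorem iteratedDiff_sum_comp {A A' ι : Type*} [AddCommMonoid A] [AddCommMonoid A'] [Fintype ι]
    {m : ℕ} (φ : ι → A' → ℝ) (L : ι → A →+ A') (p : Fin m → A) :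
    iteratedDiff (fun x => ∑ l, φ l (L l x)) p = ∑ l, iteratedDiff (φ l) fun j => L l (p j) := by
  unfold iteratedDiff
  rw [Finset.sum_comm]
  refine Finset.sum_congr rfl fun ε _ => ?_
  rw [Finset.mul_sum]
  refine Finset.sum_congr rfl fun l _ => ?_
  rw [map_sum]
  simp only [apply_ite (L l), map_zero]

/-- A function on `ℚ` one of whose iterated differences is the restriction of a `C^s` function is
itself the restriction of a `C^s` function. -/
theorem contDiff_extension_of_iteratedDiff {s : ℕ} (m : ℕ) {φ : ℚ → ℝ}
    (h : ∃ G : (Fin (m + 1) → ℝ) → ℝ, ContDiff ℝ s G ∧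
      ∀ p : Fin (m + 1) → ℚ, G (fun j => (p j : ℝ)) = iteratedDiff φ p) :
    ∃ g : ℝ → ℝ, ContDiff ℝ s g ∧ ∀ x : ℚ, g x = φ x := by
  induction m with
  | zero =>
    obtain ⟨G, hG, hGφ⟩ := h
    -- The difference of order one is `φ 0 - φ x`.
    refine ⟨fun x => φ 0 - G fun _ => x, contDiff_const.sub (hG.comp (by fun_prop)), fun x => ?_⟩
    have h0 := hGφ fun _ => x
    have h1 : (fun _ => x : Fin 1 → ℚ) = (0 : Fin 1).insertNth x Fin.elim0 := by
      funext j; fin_cases j; rfl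
    rw [h1, iteratedDiff_insertNth] at h0
    simp [iteratedDiff] at h0
    simp [h0]
  | succ m ih =>
    refine ih (contDiff_extension_of_separate_cauchy_differences fun i => ?_)
    obtain ⟨G, hG, hGφ⟩ := h
    refine ⟨fun q => - G (Fin.cons q.1 (Fin.cons q.2.1 (i.removeNth q.2.2) : Fin (m + 1) → ℝ)),
      (hG.comp ?_).neg, fun x y p => ?_⟩
    · refine contDiff_pi.2 fun j => Fin.cases ?_ (fun j => Fin.cases ?_ (fun j => ?_) j) j
      · simpa using contDiff_fst
      · simp only [Fin.cons_succ, Fin.cons_zero]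
        fun_prop
      · simp only [Fin.cons_succ, Fin.removeNth]
        fun_prop
    · simp only [← Fin.insertNth_removeNth]
      rw [iteratedDiff_add_sub, ← hGφ]
      congr 2
      funext j
      refine Fin.cases ?_ (fun j => Fin.cases ?_ (fun j => ?_) j) j <;> simp [Fin.removeNth]

/-! ### Ridge sums -/

/-- The component of `u` orthogonal to `v` is nonzero by independence; rescale it. -/
theorem exists_inner_eq_zero_and_inner_eq_one {E : Type*} [NormedAddCommGroup E]
    [InnerProductSpace ℝ E] {u v : E} (h : LinearIndependent ℝ ![u, v]) :
    ∃ b : E, inner ℝ u b = 1 ∧ inner ℝ v b = 0 := by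
  have hv : v ≠ 0 := by simpa using h.ne_zero 1
  have hvv : inner ℝ v v ≠ 0 := inner_self_ne_zero.2 hv
  let w := u - (inner ℝ v u / inner ℝ v v) • v
  have hvw : inner ℝ v w = 0 := by
    simp only [w, inner_sub_right, inner_smul_right]
    field_simp
    ring
  have huw : inner ℝ u w = inner ℝ w w := by
    have h1 : u = w + (inner ℝ v u / inner ℝ v v) • v := by simp [w]
    conv_lhs => rw [h1]
    rw [inner_add_left, inner_smul_left, hvw]
    simp
  have hw : w ≠ 0 := by
    intro hw
    have := LinearIndependent.pair_iff.1 h 1 (-(inner ℝ v u / inner ℝ v v))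
      (by rw [one_smul, neg_smul, ← sub_eq_add_neg]; exact hw)
    exact one_ne_zero this.1
  have hww : inner ℝ w w ≠ 0 := inner_self_ne_zero.2 hw
  refine ⟨(inner ℝ w w)⁻¹ • w, ?_, ?_⟩
  · rw [inner_smul_right, huw, inv_mul_cancel₀ hww]
  · rw [inner_smul_right, hvw, mul_zero]

/-- Each summand of a `C^s` sum of ridge functions with pairwise independent directions agrees on
`ℚ` with a `C^s` function. -/
theorem exists_contDiff_eq_on_rat_of_ridge_sum {E : Type*} [NormedAddCommGroup E]
    [InnerProductSpace ℝ E] {k s : ℕ} {a : Fin k → E}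
    (ha : ∀ i j : Fin k, i ≠ j → LinearIndependent ℝ ![a i, a j]) {f : E → ℝ}
    (hf : ContDiff ℝ s f) {φ : Fin k → ℝ → ℝ} (hφ : ∀ x, f x = ∑ i, φ i (inner ℝ (a i) x))
    {i : Fin k} (hi : a i ≠ 0) : ∃ g : ℝ → ℝ, ContDiff ℝ s g ∧ ∀ x : ℚ, g x = φ i x := by
  have hb : ∀ j, ∃ b : E, inner ℝ (a i) b = 1 ∧ (j ≠ i → inner ℝ (a j) b = 0) := by
    intro j
    by_cases hj : j = i
    · refine ⟨(inner ℝ (a i) (a i))⁻¹ • a i, ?_, fun h => (h hj).elim⟩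
      rw [inner_smul_right, inv_mul_cancel₀ (inner_self_ne_zero.2 hi)]
    · obtain ⟨b, h1, h2⟩ := exists_inner_eq_zero_and_inner_eq_one (ha i j (Ne.symm hj))
      exact ⟨b, h1, fun _ => h2⟩
  choose b hb1 hb0 using hb
  have hdiff : ∀ p : Fin k → ℝ,
      iteratedDiff f (fun j => p j • b j) = iteratedDiff (φ i) p := by
    intro p
    rw [show f = fun x => ∑ l, φ l ((innerₗ E (a l)).toAddMonoidHom x) from funext hφ,
      iteratedDiff_sum_comp, Finset.sum_eq_single i]
    · congr 1
      funext j
      simp [hb1]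
    -- The `l`-th increment vanishes under `⟪a l, ·⟫`.
    · intro l _ hl
      refine iteratedDiff_eq_zero _ l ?_
      simp [hb0 l hl]
    · simp
  obtain ⟨m, rfl⟩ : ∃ m, k = m + 1 := ⟨k - 1, by have := i.isLt; omega⟩
  refine contDiff_extension_of_iteratedDiff m (φ := fun x : ℚ => φ i x)
    ⟨fun p => iteratedDiff f fun j => p j • b j, ?_, fun p => ?_⟩
  · unfold iteratedDiff
    refine ContDiff.sum fun ε _ => contDiff_const.mul (hf.comp (ContDiff.sum fun j _ => ?_))
    split_ifs
    · exact (contDiff_apply ℝ ℝ j).smul contDiff_const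
    · exact contDiff_const
  · beta_reduce
    rw [hdiff]
    unfold iteratedDiff
    refine Finset.sum_congr rfl fun ε _ => ?_
    congr 2
    push_cast
    refine Finset.sum_congr rfl fun j _ => ?_
    split_ifs <;> simp

theorem corollary4p2 (n k s : ℕ)
    (a : Fin k → EuclideanSpace ℝ (Fin n))
    (ha : ∀ i j : Fin k, i ≠ j → LinearIndependent ℝ ![a i, a j])
    (hT : ∃ T : EuclideanSpace ℝ (Fin n) ≃ₗ[ℝ] EuclideanSpace ℝ (Fin n),
      ∀ (i : Fin k) (j : Fin n), ∃ q : ℚ, T (a i) j = (q : ℝ))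
    (f : EuclideanSpace ℝ (Fin n) → ℝ) (hf : ContDiff ℝ s f)
    (hrep : ∃ φ : Fin k → ℝ → ℝ, ∀ x, f x = ∑ i, φ i (inner ℝ (a i) x)) :
    ∃ g : Fin k → ℝ → ℝ, (∀ i, ContDiff ℝ s (g i)) ∧
      ∀ x, f x = ∑ i, g i (inner ℝ (a i) x) := by
  obtain ⟨φ, hφ⟩ := hrep
  obtain ⟨T, hT⟩ := hT
  choose q hq using hT
  have hg : ∀ i, ∃ g : ℝ → ℝ, ContDiff ℝ s g ∧
      ∀ x, (∃ r : ℚ, inner ℝ (a i) x = r) → g (inner ℝ (a i) x) = φ i (inner ℝ (a i) x) := by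
    intro i
    by_cases hi : a i = 0
    · exact ⟨fun _ => φ i 0, contDiff_const, fun x _ => by simp [hi]⟩
    · obtain ⟨g, hg, hgφ⟩ := exists_contDiff_eq_on_rat_of_ridge_sum ha hf hφ hi
      exact ⟨g, hg, fun x ⟨r, hr⟩ => by rw [hr, hgφ]⟩
  choose g hg hgφ using hg
  refine ⟨g, hg, ?_⟩
  let T' := LinearMap.adjoint (T : EuclideanSpace ℝ (Fin n) →ₗ[ℝ] EuclideanSpace ℝ (Fin n))
  -- For `x = T' p` with `p` rational, `⟪a i, x⟫ = ⟪T (a i), p⟫` is rational.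
  let e : (Fin n → ℚ) → EuclideanSpace ℝ (Fin n) := fun p => T' (WithLp.toLp 2 fun j => (p j : ℝ))
  have hT' : Function.Surjective T' := by
    intro y
    refine ⟨LinearMap.adjoint
      (T.symm : EuclideanSpace ℝ (Fin n) →ₗ[ℝ] EuclideanSpace ℝ (Fin n)) y, ?_⟩
    refine ext_inner_left ℝ fun v => ?_
    simp only [T', LinearMap.adjoint_inner_right, LinearEquiv.coe_coe, LinearEquiv.symm_apply_apply]
  have he : DenseRange e := by
    have h1 : DenseRange fun p : Fin n → ℚ =>
        (WithLp.toLp 2 fun j => (p j : ℝ) : EuclideanSpace ℝ (Fin n)) :=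
      (WithLp.toLp_surjective 2).denseRange.comp (denseRange_ratCast_pi (Fin n))
        (PiLp.continuous_toLp 2 _)
    exact hT'.denseRange.comp h1 T'.continuous_of_finiteDimensional
  have hfc : Continuous f := hf.continuous
  have hgc : ∀ i, Continuous (g i) := fun i => (hg i).continuous
  refine congrFun (he.equalizer (g := f) (h := fun x => ∑ i, g i (inner ℝ (a i) x)) hfc
    (by fun_prop) (funext fun p => ?_))
  simp only [Function.comp_apply]
  rw [hφ]
  refine Finset.sum_congr rfl fun i _ => (hgφ i _ ⟨∑ j, q i j * p j, ?_⟩).symm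
  simp only [e, T', LinearMap.adjoint_inner_right, LinearEquiv.coe_coe]
  rw [PiLp.inner_apply]
  push_cast
  exact Finset.sum_congr rfl fun j _ => by simp [hq, mul_comm]
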